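/- Let $(Y,d)$ be a complete separable metric space, $N\ge 2$, and let $\sigma_0,\dots,\sigma_{N-1}:Y\to Y$ be Lipschitz contractions (an iterated function system, possibly with essential overlap). Let $X\subseteq Y$ be its attractor, i.e. the non-empty compact set with $X=\bigcup_{i}\sigma_i(X)$, and let $\mu$ be its Hutchinson measure, i.e. the Borel probability measure on $Y$ that integrates every real Lipschitz function and satisfies $\mu(\Delta)=\frac1N\sum_{i}\mu(\sigma_i^{-1}(\Delta))$ for all Borel $\Delta$; regard $\mu$ as a measure on $X$. On the complex Hilbert space $L^2(X,\mu)$ put $F_i\varphi=\frac1{\sqrt N}\,\varphi\circ\sigma_i$ and $S_i=F_i^*$. Let $\Gamma_N=\{0,\dots,N-1\}$, let $\Omega=\Gamma_N^{\mathbb N}$ carry the Bernoulli measure $P$ (the product of the uniform distributions), and let $\eta_i(\alpha_1,\alpha_2,\dots)=(i,\alpha_1,\alpha_2,\dots)$, $\eta(\alpha_1,\alpha_2,\alpha_3,\dots)=(\alpha_2,\alpha_3,\dots)$. On $L^2(\Omega,P)$ put $T_i\varphi=\sqrt N\,(\varphi\circ\eta)\,\mathbf 1_{\eta_i(\Omega)}$.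 Let $\pi:\Omega\to X$ be the coding map: $\pi(\alpha)$ is the unique point of $\bigcap_{n\ge1}\sigma_{\alpha_1}\circ\cdots\circ\sigma_{\alpha_n}(X)$. A positive operator-valued measure (POVM) with respect to $(Z,\mathcal H)$ is a map $B$ from the Borel sets of $Z$ to the positive bounded operators on $\mathcal H$ with $B(\emptyset)=0$, $B(Z)=\mathrm{id}_{\mathcal H}$ and $\langle B(\bigcup_n\Delta_n)g,h\rangle=\sum_n\langle B(\Delta_n)g,h\rangle$ for all $g,h\in\mathcal H$ and all sequences of pairwise disjoint Borel sets $\Delta_n$; it is a projection-valued measure (PVM) if moreover each $B(\Delta)$ is an orthogonal projection and $B(\Delta_1\cap\Delta_2)=B(\Delta_1)B(\Delta_2)$. **Theorem.** There are a unique PVM $E$ with respect to $(\Omega,L^2(\Omega,P))$ with $E(\cdot)=\sum_{i=0}^{N-1}T_iE(\eta_i^{-1}(\cdot))T_i^*$ and a unique POVM $A$ with respect to $(X,L^2(X,\mu))$ with $A(\cdot)=\sum_{i=0}^{N-1}S_iA(\sigma_i^{-1}(\cdot))S_i^*$. The formula $Vf=f\circ\pi$ defines a linear isometry $V:L^2(X,\mu)\to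 L^2(\Omega,P)$, the map $\Delta\mapsto E(\pi^{-1}(\Delta))$ is a PVM with respect to $(X,L^2(\Omega,P))$, and $$V^*E(\pi^{-1}(\Delta))V=A(\Delta)\qquad\text{for every Borel set }\Delta\subseteq X,$$ so that $E\circ\pi^{-1}$ is an explicit Naimark dilation of $A$. -/

import Mathlib

open MeasureTheory Set
open scoped NNReal ENNReal InnerProductSpace

noncomputable section

/-! ## Operator-valued measures -/

/-- The measurable subsets of a measurable space (the Borel sets, for a Borel space). -/
abbrev MSet (X : Type*) [MeasurableSpace X] : Type _ := {Δ : Set X // MeasurableSet Δ}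

/-- The preimage of a measurable set under a measurable map. -/
def MSet.preimage {X Z : Type*} [MeasurableSpace X] [MeasurableSpace Z] {g : X → Z}
    (hg : Measurable g) (Δ : MSet Z) : MSet X :=
  ⟨g ⁻¹' Δ.1, hg Δ.2⟩

/-- `A` is a positive operator-valued measure with respect to the pair `(X, H)`. -/
structure IsPOVM {X H : Type*} [MeasurableSpace X] [NormedAddCommGroup H]
    [InnerProductSpace ℂ H] [CompleteSpace H] (A : MSet X → H →L[ℂ] H) : Prop where
  isPositive : ∀ Δ, (A Δ).IsPositive
  empty : A ⟨∅, MeasurableSet.empty⟩ = 0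
  univ : A ⟨Set.univ, MeasurableSet.univ⟩ = ContinuousLinearMap.id ℂ H
  iUnion : ∀ Δ : ℕ → MSet X, Pairwise (fun m n => Disjoint (Δ m).1 (Δ n).1) → ∀ g h : H,
    HasSum (fun n => ⟪h, A (Δ n) g⟫_ℂ)
      ⟪h, A ⟨⋃ n, (Δ n).1, MeasurableSet.iUnion fun n => (Δ n).2⟩ g⟫_ℂ

/-- `E` is a projection-valued measure with respect to the pair `(X, H)`. -/
structure IsPVM {X H : Type*} [MeasurableSpace X] [NormedAddCommGroup H]
    [InnerProductSpace ℂ H] [CompleteSpace H] (E : MSet X → H →L[ℂ] H) : Prop where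
  isProjection : ∀ Δ, IsStarProjection (E Δ)
  empty : E ⟨∅, MeasurableSet.empty⟩ = 0
  univ : E ⟨Set.univ, MeasurableSet.univ⟩ = ContinuousLinearMap.id ℂ H
  inter : ∀ Δ₁ Δ₂ : MSet X, E ⟨Δ₁.1 ∩ Δ₂.1, Δ₁.2.inter Δ₂.2⟩ = E Δ₁ ∘L E Δ₂
  iUnion : ∀ Δ : ℕ → MSet X, Pairwise (fun m n => Disjoint (Δ m).1 (Δ n).1) → ∀ g h : H,
    HasSum (fun n => ⟪h, E (Δ n) g⟫_ℂ)
      ⟪h, E ⟨⋃ n, (Δ n).1, MeasurableSet.iUnion fun n => (Δ n).2⟩ g⟫_ℂ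

/-! ## Composition and restriction operators on `L²` -/

section L2Operators

variable {α β : Type*} [MeasurableSpace α] [MeasurableSpace β]

theorem memLp_comp_of_map_le {μ : Measure α} {ν : Measure β} {g : α → β} (hg : Measurable g)
    {c : ℝ≥0} (hc : μ.map g ≤ c • ν) (φ : Lp ℂ 2 ν) : MemLp (φ ∘ g) 2 μ := by
  have h : MemLp φ 2 (μ.map g) := (Lp.memLp φ).of_measure_le_smul ENNReal.coe_ne_top hc
  exact h.comp_of_map hg.aemeasurable

theorem quasiMeasurePreserving_of_map_le {μ : Measure α} {ν : Measure β} {g : α → β}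
    (hg : Measurable g) {c : ℝ≥0} (hc : μ.map g ≤ c • ν) :
    Measure.QuasiMeasurePreserving g μ ν :=
  ⟨hg, (Measure.absolutelyContinuous_of_le hc).trans Measure.smul_absolutelyContinuous⟩

/-- The composition operator `φ ↦ φ ∘ g` from `L²(ν)` to `L²(μ)`, bounded because the image
measure of `μ` under `g` is at most `c • ν`. -/
def compL2 {μ : Measure α} {ν : Measure β} {g : α → β} (hg : Measurable g)
    {c : ℝ≥0} (hc : μ.map g ≤ c • ν) : Lp ℂ 2 ν →L[ℂ] Lp ℂ 2 μ :=
  LinearMap.mkContinuous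
    { toFun := fun φ => (memLp_comp_of_map_le hg hc φ).toLp (φ ∘ g)
      map_add' := by
        intro φ ψ
        rw [← MemLp.toLp_add]
        refine MemLp.toLp_congr _ _ ?_
        exact (quasiMeasurePreserving_of_map_le hg hc).ae_eq_comp (Lp.coeFn_add φ ψ)
      map_smul' := by
        intro a φ
        rw [RingHom.id_apply, ← MemLp.toLp_const_smul]
        refine MemLp.toLp_congr _ _ ?_
        exact (quasiMeasurePreserving_of_map_le hg hc).ae_eq_comp (Lp.coeFn_smul a φ) }
    (((c : ℝ≥0∞) ^ (1 / (2 : ℝ≥0∞)).toReal).toReal) (by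
      intro φ
      have hφ : AEStronglyMeasurable φ (μ.map g) :=
        ((Lp.memLp φ).of_measure_le_smul ENNReal.coe_ne_top hc).1
      have h1 : eLpNorm (φ ∘ g) 2 μ ≤
          (c : ℝ≥0∞) ^ (1 / (2 : ℝ≥0∞)).toReal * eLpNorm φ 2 ν := by
        rw [← eLpNorm_map_measure hφ hg.aemeasurable]
        exact (eLpNorm_mono_measure _ hc).trans (eLpNorm_smul_measure_le (c : ℝ≥0∞) _ _ _)
      change ‖(memLp_comp_of_map_le hg hc φ).toLp (φ ∘ g)‖ ≤ _
      rw [Lp.norm_toLp, Lp.norm_def, ← ENNReal.toReal_mul]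
      refine ENNReal.toReal_mono ?_ h1
      exact ENNReal.mul_ne_top (ENNReal.rpow_ne_top_of_nonneg ENNReal.toReal_nonneg
        ENNReal.coe_ne_top) (Lp.eLpNorm_ne_top φ))

theorem coeFn_compL2 {μ : Measure α} {ν : Measure β} {g : α → β} (hg : Measurable g)
    {c : ℝ≥0} (hc : μ.map g ≤ c • ν) (φ : Lp ℂ 2 ν) : compL2 hg hc φ =ᵐ[μ] φ ∘ g := by
  have h : compL2 hg hc φ = (memLp_comp_of_map_le hg hc φ).toLp (φ ∘ g) := rfl
  rw [h]
  exact MemLp.coeFn_toLp (memLp_comp_of_map_le hg hc φ)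

/-- The operator `φ ↦ 1_s φ` on `L²(μ)`. -/
def indicatorL2 (μ : Measure α) {s : Set α} (hs : MeasurableSet s) :
    Lp ℂ 2 μ →L[ℂ] Lp ℂ 2 μ :=
  LinearMap.mkContinuous
    { toFun := fun φ => ((Lp.memLp φ).indicator hs).toLp (s.indicator φ)
      map_add' := by
        intro φ ψ
        rw [← MemLp.toLp_add]
        refine MemLp.toLp_congr _ _ ?_
        filter_upwards [Lp.coeFn_add φ ψ] with x hx
        by_cases h : x ∈ s
        · rw [Pi.add_apply, Set.indicator_of_mem h, Set.indicator_of_mem h,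
            Set.indicator_of_mem h, hx, Pi.add_apply]
        · simp [h]
      map_smul' := by
        intro a φ
        rw [RingHom.id_apply, ← MemLp.toLp_const_smul]
        refine MemLp.toLp_congr _ _ ?_
        filter_upwards [Lp.coeFn_smul a φ] with x hx
        by_cases h : x ∈ s
        · rw [Pi.smul_apply, Set.indicator_of_mem h, Set.indicator_of_mem h, hx,
            Pi.smul_apply]
        · simp [h] }
    1 (by
      intro φ
      change ‖((Lp.memLp φ).indicator hs).toLp (s.indicator φ)‖ ≤ _
      rw [Lp.norm_toLp, Lp.norm_def, one_mul]
      exact ENNReal.toReal_mono (Lp.eLpNorm_ne_top φ) (eLpNorm_indicator_le _))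

theorem coeFn_indicatorL2 (μ : Measure α) {s : Set α} (hs : MeasurableSet s) (φ : Lp ℂ 2 μ) :
    indicatorL2 μ hs φ =ᵐ[μ] s.indicator φ := by
  have hf : MemLp (s.indicator (φ : α → ℂ)) 2 μ := (Lp.memLp φ).indicator hs
  have h : indicatorL2 μ hs φ = hf.toLp (s.indicator (φ : α → ℂ)) := rfl
  rw [h]
  exact MemLp.coeFn_toLp hf

end L2Operators

/-! ## The sequence space -/

/-- The sequence space `Ω = Γ_N^ℕ`, where `Γ_N = {0, …, N - 1}`. -/
abbrev SeqSpace (N : ℕ) : Type := ℕ → Fin N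

/-- The Bernoulli measure on `Ω`: the product of the uniform distributions on `Γ_N`. -/
def bernoulliMeasure (N : ℕ) : Measure (SeqSpace N) :=
  Measure.infinitePi fun _ : ℕ => ProbabilityTheory.uniformOn (Set.univ : Set (Fin N))

/-- The map `η_i (α₁, α₂, …) = (i, α₁, α₂, …)`. -/
def prepend {N : ℕ} (i : Fin N) (α : SeqSpace N) : SeqSpace N
  | 0 => i
  | n + 1 => α n

/-- The map `η (α₁, α₂, α₃, …) = (α₂, α₃, …)`. -/
def shift {N : ℕ} (α : SeqSpace N) : SeqSpace N := fun n => α (n + 1)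

theorem measurable_prepend {N : ℕ} (i : Fin N) : Measurable (prepend i) := by
  refine measurable_pi_lambda _ fun n => ?_
  cases n with
  | zero => exact measurable_const
  | succ n => exact measurable_pi_apply n

theorem measurable_shift {N : ℕ} : Measurable (shift (N := N)) :=
  measurable_pi_lambda _ fun n => measurable_pi_apply (n + 1)

theorem range_prepend {N : ℕ} (i : Fin N) :
    Set.range (prepend i) = {α : SeqSpace N | α 0 = i} := by
  ext α
  constructor
  · rintro ⟨β, rfl⟩
    rfl
  · intro h
    refine ⟨shift α, ?_⟩
    funext n
    cases n with
    | zero => exact h.symm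
    | succ n => rfl

theorem measurableSet_range_prepend {N : ℕ} (i : Fin N) :
    MeasurableSet (Set.range (prepend i)) := by
  rw [range_prepend]
  exact measurableSet_eq_fun (measurable_pi_apply 0) measurable_const

theorem map_shift_bernoulliMeasure (N : ℕ) : (bernoulliMeasure N).map shift = bernoulliMeasure N := by
  rcases isEmpty_or_nonempty (Fin N) with h | h
  · exact Subsingleton.elim _ _
  · have : IsProbabilityMeasure (ProbabilityTheory.uniformOn (Set.univ : Set (Fin N))) :=
      ProbabilityTheory.isProbabilityMeasure_uniformOn Set.finite_univ Set.univ_nonempty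
    refine Measure.eq_infinitePi _ fun s t ht => ?_
    rw [Measure.map_apply measurable_shift
      (MeasurableSet.pi s.countable_toSet fun i _ => ht i)]
    have hpre : (shift (N := N)) ⁻¹' (Set.pi s t) =
        Set.pi (s.map (addRightEmbedding 1)) (fun n => t (n - 1)) := by
      ext α
      simp [shift, Set.mem_pi]
    rw [hpre, bernoulliMeasure, Measure.infinitePi_pi _ fun i _ => ht _]
    simp

/-- The operator `T_i φ = √N (φ ∘ η) 1_{η_i(Ω)}` on `L²(Ω, P)`. -/
def cuntzT {N : ℕ} (i : Fin N) : Lp ℂ 2 (bernoulliMeasure N) →L[ℂ] Lp ℂ 2 (bernoulliMeasure N) :=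
  ((Real.sqrt N : ℝ) : ℂ) • (indicatorL2 (bernoulliMeasure N) (measurableSet_range_prepend i) ∘L
    compL2 (c := 1) measurable_shift (by rw [one_smul, map_shift_bernoulliMeasure]))

/-- `E(·) = ∑ i, T_i E(η_i⁻¹(·)) T_i*`. -/
def IsCuntzFixed {N : ℕ}
    (E : MSet (SeqSpace N) → Lp ℂ 2 (bernoulliMeasure N) →L[ℂ] Lp ℂ 2 (bernoulliMeasure N)) : Prop :=
  ∀ Δ, E Δ = ∑ i : Fin N, cuntzT i ∘L E (Δ.preimage (measurable_prepend i)) ∘L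
    ContinuousLinearMap.adjoint (cuntzT i)

/-! ## Iterated function systems -/

/-- An iterated function system: a family of `N` Lipschitz contractions. -/
structure IFS (Y : Type*) [MetricSpace Y] (N : ℕ) where
  map : Fin N → Y → Y
  contracting : ∀ i, ∃ r : ℝ≥0, ContractingWith r (map i)

namespace IFS

variable {Y : Type*} [MetricSpace Y] {N : ℕ}

/-- `X` is the attractor set of the system. -/
structure IsAttractor (S : IFS Y N) (X : Set Y) : Prop where
  nonempty : X.Nonempty
  isCompact : IsCompact X
  eq_iUnion : X = ⋃ i, S.map i '' X

/-- `μ` is the Hutchinson measure of the system: a Borel probability measure which integrates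
all Lipschitz functions, with `μ = ∑ i, (1 / N) μ(σ_i⁻¹(·))`. -/
structure IsHutchinsonMeasure [MeasurableSpace Y] (S : IFS Y N) (μ : Measure Y) : Prop where
  isProbabilityMeasure : IsProbabilityMeasure μ
  integrable : ∀ f : Y → ℝ, (∃ K : ℝ≥0, LipschitzWith K f) → Integrable f μ
  fixed : ∀ Δ, MeasurableSet Δ → μ Δ = ∑ i, (1 / (N : ℝ≥0∞)) * μ (S.map i ⁻¹' Δ)

/-- `μ` as a measure on the type `X`. -/
abbrev onSubtype [MeasurableSpace Y] (μ : Measure Y) (X : Set Y) : Measure X :=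
  μ.comap Subtype.val

theorem continuous_map (S : IFS Y N) (i : Fin N) : Continuous (S.map i) :=
  let ⟨_, h⟩ := S.contracting i
  h.2.continuous

theorem exists_ratio (S : IFS Y N) : ∃ r : ℝ≥0, r < 1 ∧ ∀ i, LipschitzWith r (S.map i) := by
  choose r hr using S.contracting
  refine ⟨Finset.univ.sup r, ?_, fun i => (hr i).2.weaken (Finset.le_sup (Finset.mem_univ i))⟩
  exact (Finset.sup_lt_iff (by simp)).2 fun i _ => (hr i).1

theorem IsAttractor.map_mem {S : IFS Y N} {X : Set Y} (hX : S.IsAttractor X) (i : Fin N) {x : Y}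
    (hx : x ∈ X) : S.map i x ∈ X := by
  rw [hX.eq_iUnion]
  exact Set.mem_iUnion.2 ⟨i, x, hx, rfl⟩

/-- `σ_i` as a map of the attractor `X` to itself. -/
def IsAttractor.restrict {S : IFS Y N} {X : Set Y} (hX : S.IsAttractor X) (i : Fin N) (x : X) :
    X :=
  ⟨S.map i x, hX.map_mem i x.2⟩

/-- `σ_{α₁} ∘ ⋯ ∘ σ_{α_n}`. -/
def word (S : IFS Y N) (α : SeqSpace N) : ℕ → Y → Y
  | 0 => id
  | n + 1 => S.map (α 0) ∘ S.word (shift α) n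

theorem lipschitzWith_word (S : IFS Y N) {r : ℝ≥0} (hr : ∀ i, LipschitzWith r (S.map i)) (n : ℕ) :
    ∀ α : SeqSpace N, LipschitzWith (r ^ n) (S.word α n) := by
  induction n with
  | zero => intro α; simpa [word] using LipschitzWith.id
  | succ n ih =>
    intro α
    rw [pow_succ']
    exact (hr _).comp (ih _)

theorem IsAttractor.image_word_subset {S : IFS Y N} {X : Set Y} (hX : S.IsAttractor X) (n : ℕ) :
    ∀ α : SeqSpace N, S.word α n '' X ⊆ X := by
  induction n with
  | zero => intro α; simp [word]
  | succ n ih =>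
    intro α
    rw [word, Set.image_comp]
    rintro _ ⟨y, hy, rfl⟩
    exact hX.map_mem _ (ih _ hy)

theorem IsAttractor.image_word_succ_subset {S : IFS Y N} {X : Set Y} (hX : S.IsAttractor X)
    (n : ℕ) : ∀ α : SeqSpace N, S.word α (n + 1) '' X ⊆ S.word α n '' X := by
  induction n with
  | zero => intro α; simpa [word] using hX.image_word_subset 1 α
  | succ n ih =>
    intro α
    have h := ih (shift α)
    rw [word, Set.image_comp]
    conv_rhs => rw [word, Set.image_comp]
    exact Set.image_mono h

theorem IsAttractor.existsUnique_code {S : IFS Y N} {X : Set Y} (hX : S.IsAttractor X)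
    (α : SeqSpace N) : ∃ x : X, ⋂ n : ℕ, S.word α (n + 1) '' X = {(x : Y)} := by
  obtain ⟨r, hr1, hr⟩ := S.exists_ratio
  have hcpt : ∀ n, IsCompact (S.word α (n + 1) '' X) := fun n =>
    hX.isCompact.image (S.lipschitzWith_word hr (n + 1) α).continuous
  obtain ⟨x, hx⟩ := IsCompact.nonempty_iInter_of_sequence_nonempty_isCompact_isClosed
    (fun n => S.word α (n + 1) '' X) (fun n => hX.image_word_succ_subset (n + 1) α)
    (fun n => hX.nonempty.image _) (hcpt 0) (fun n => (hcpt n).isClosed)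
  have hxX : x ∈ X := hX.image_word_subset 1 α (Set.mem_iInter.1 hx 0)
  refine ⟨⟨x, hxX⟩, Set.eq_singleton_iff_unique_mem.2 ⟨hx, fun y hy => ?_⟩⟩
  have key : ∀ n : ℕ, dist y x ≤ (r : ℝ) ^ (n + 1) * Metric.diam X := by
    intro n
    obtain ⟨u, hu, hu'⟩ := Set.mem_iInter.1 hy n
    obtain ⟨v, hv, hv'⟩ := Set.mem_iInter.1 hx n
    rw [← hu', ← hv']
    have h := (S.lipschitzWith_word hr (n + 1) α).dist_le_mul u v
    push_cast at h
    exact h.trans (mul_le_mul_of_nonneg_left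
      (Metric.dist_le_diam_of_mem hX.isCompact.isBounded hu hv) (by positivity))
  have hlim : Filter.Tendsto (fun n : ℕ => (r : ℝ) ^ (n + 1) * Metric.diam X) Filter.atTop
      (nhds (0 * Metric.diam X)) :=
    ((tendsto_pow_atTop_nhds_zero_of_lt_one r.2 (by exact_mod_cast hr1)).comp
      (Filter.tendsto_add_atTop_nat 1)).mul_const _
  rw [zero_mul] at hlim
  exact dist_le_zero.1 (ge_of_tendsto' hlim key)

/-- The coding map `π : Ω → X`: `π(α)` is the point of `⋂ n ≥ 1, σ_{α₁} ∘ ⋯ ∘ σ_{α_n} (X)`. -/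
def IsAttractor.coding {S : IFS Y N} {X : Set Y} (hX : S.IsAttractor X) (α : SeqSpace N) : X :=
  Classical.choose (hX.existsUnique_code α)

theorem IsAttractor.iInter_word {S : IFS Y N} {X : Set Y} (hX : S.IsAttractor X)
    (α : SeqSpace N) : ⋂ n : ℕ, S.word α (n + 1) '' X = {(hX.coding α : Y)} :=
  Classical.choose_spec (hX.existsUnique_code α)

theorem continuous_word (S : IFS Y N) (n : ℕ) (y : Y) :
    Continuous fun α : SeqSpace N => S.word α n y := by
  induction n with
  | zero => exact continuous_const
  | succ n ih =>
    have h1 : Continuous fun p : Fin N × Y => S.map p.1 p.2 :=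
      continuous_prod_of_discrete_left.2 fun i => S.continuous_map i
    have h2 : Continuous (shift (N := N)) :=
      continuous_pi fun n => continuous_apply (n + 1)
    exact h1.comp ((continuous_apply 0).prodMk (ih.comp h2))

theorem IsAttractor.continuous_coding {S : IFS Y N} {X : Set Y} (hX : S.IsAttractor X) :
    Continuous hX.coding := by
  obtain ⟨r, hr1, hr⟩ := S.exists_ratio
  obtain ⟨x₀, hx₀⟩ := hX.nonempty
  rw [continuous_induced_rng]
  have hlim : Filter.Tendsto (fun n : ℕ => (r : ℝ) ^ (n + 1) * Metric.diam X) Filter.atTop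
      (nhds (0 * Metric.diam X)) :=
    ((tendsto_pow_atTop_nhds_zero_of_lt_one r.2 (by exact_mod_cast hr1)).comp
      (Filter.tendsto_add_atTop_nat 1)).mul_const _
  rw [zero_mul] at hlim
  have hu : TendstoUniformly (fun (n : ℕ) (α : SeqSpace N) => S.word α (n + 1) x₀)
      (Subtype.val ∘ hX.coding) Filter.atTop := by
    rw [Metric.tendstoUniformly_iff]
    intro ε hε
    filter_upwards [hlim.eventually (gt_mem_nhds hε)] with n hn α
    refine lt_of_le_of_lt ?_ hn
    have hmem : (hX.coding α : Y) ∈ ⋂ n : ℕ, S.word α (n + 1) '' X := by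
      rw [hX.iInter_word]; exact Set.mem_singleton _
    obtain ⟨u, hu, hu'⟩ := Set.mem_iInter.1 hmem n
    have h := (S.lipschitzWith_word hr (n + 1) α).dist_le_mul u x₀
    push_cast at h
    rw [Function.comp_apply, ← hu']
    exact h.trans (mul_le_mul_of_nonneg_left
      (Metric.dist_le_diam_of_mem hX.isCompact.isBounded hu hx₀) (by positivity))
  exact hu.continuous (Filter.Frequently.of_forall fun n => S.continuous_word (n + 1) x₀)

section Measurability

variable [MeasurableSpace Y] [BorelSpace Y]

theorem IsAttractor.measurable_restrict {S : IFS Y N} {X : Set Y} (hX : S.IsAttractor X)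
    (i : Fin N) : Measurable (hX.restrict i) :=
  (((S.continuous_map i).comp continuous_subtype_val).subtype_mk _).measurable

theorem IsAttractor.measurable_coding {S : IFS Y N} {X : Set Y} (hX : S.IsAttractor X) :
    Measurable hX.coding :=
  hX.continuous_coding.measurable

theorem IsAttractor.map_restrict_le {S : IFS Y N} {X : Set Y} (hX : S.IsAttractor X)
    {μ : Measure Y} (hμ : S.IsHutchinsonMeasure μ) (i : Fin N) :
    (onSubtype μ X).map (hX.restrict i) ≤ (N : ℝ≥0) • onSubtype μ X := by
  have hXm : MeasurableSet X := hX.isCompact.isClosed.measurableSet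
  have hN : (N : ℝ≥0∞) ≠ 0 := by
    have := i.pos
    exact_mod_cast this.ne'
  refine Measure.le_iff.2 fun Δ hΔ => ?_
  rw [Measure.map_apply (hX.measurable_restrict i) hΔ]
  change (onSubtype μ X) _ ≤ ((N : ℝ≥0) : ℝ≥0∞) * (onSubtype μ X) Δ
  rw [comap_subtype_coe_apply hXm, comap_subtype_coe_apply hXm]
  have hΔ' : MeasurableSet (Subtype.val '' Δ : Set Y) := hXm.subtype_image hΔ
  rw [hμ.fixed _ hΔ', ← Finset.mul_sum, ← mul_assoc]
  have h1 : ((N : ℝ≥0) : ℝ≥0∞) * (1 / (N : ℝ≥0∞)) = 1 := by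
    rw [one_div, ENNReal.coe_natCast]
    exact ENNReal.mul_inv_cancel hN (ENNReal.natCast_ne_top N)
  rw [h1, one_mul]
  refine le_trans (measure_mono ?_)
    (Finset.single_le_sum (f := fun j => μ (S.map j ⁻¹' (Subtype.val '' Δ)))
      (fun _ _ => zero_le) (Finset.mem_univ i))
  rintro _ ⟨x, hx, rfl⟩
  exact ⟨hX.restrict i x, hx, rfl⟩

/-- The operator `F_i φ = (1 / √N) (φ ∘ σ_i)` on `L²(X, μ)`. -/
def opF {S : IFS Y N} {X : Set Y} (hX : S.IsAttractor X) {μ : Measure Y}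
    (hμ : S.IsHutchinsonMeasure μ) (i : Fin N) :
    Lp ℂ 2 (onSubtype μ X) →L[ℂ] Lp ℂ 2 (onSubtype μ X) :=
  ((1 / Real.sqrt N : ℝ) : ℂ) • compL2 (hX.measurable_restrict i) (hX.map_restrict_le hμ i)

/-- The operator `S_i = F_i*` on `L²(X, μ)`. -/
def opS {S : IFS Y N} {X : Set Y} (hX : S.IsAttractor X) {μ : Measure Y}
    (hμ : S.IsHutchinsonMeasure μ) (i : Fin N) :
    Lp ℂ 2 (onSubtype μ X) →L[ℂ] Lp ℂ 2 (onSubtype μ X) :=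
  ContinuousLinearMap.adjoint (opF hX hμ i)

/-- `A(·) = ∑ i, S_i A(σ_i⁻¹(·)) S_i*`. -/
def IsFixed {S : IFS Y N} {X : Set Y} (hX : S.IsAttractor X) {μ : Measure Y}
    (hμ : S.IsHutchinsonMeasure μ)
    (A : MSet X → Lp ℂ 2 (onSubtype μ X) →L[ℂ] Lp ℂ 2 (onSubtype μ X)) : Prop :=
  ∀ Δ, A Δ = ∑ i : Fin N, opS hX hμ i ∘L A (Δ.preimage (hX.measurable_restrict i)) ∘L
    ContinuousLinearMap.adjoint (opS hX hμ i)

end Measurability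

end IFS

end

/-!
Multiplication by indicator functions on `L²(Ω, P)` is a PVM, and it solves the fixed-point
equation because `T_i* φ = (1 / √N) (φ ∘ η_i)` (`adjoint_cuntzT`) and the ranges of the `η_i`
partition `Ω`. The coding map satisfies `π ∘ η_i = σ_i ∘ π` and sends `P` to `μ`
(`IFS.IsHutchinsonMeasure.map_coding`), so `V f = f ∘ π` is an isometry with `V F_i = T_i* V`
(`IFS.codingIsometry_comp_opF`). Hence `Δ ↦ V* E(π⁻¹(Δ)) V` is a POVM which solves the fixed-point
equation on the attractor. Once uniqueness is known, this is both the existence of `A` and the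
dilation formula.

All uniqueness statements come from one comparison, `measure_le_of_pieces_subset`. For a POVM `A`
with `A(Δ) = ∑ i, T_i A(τ_i⁻¹(Δ)) T_i*`, the scalar measures `m_f(Δ) = ⟪f, A(Δ) f⟫` satisfy
`m_f(Δ) = ∑ i, m_{T_i* f}(τ_i⁻¹(Δ))`. If two such families have equal masses, then iterating `n`
times gives `m_f(C) ≤ m'_f(D)` whenever `D` contains every piece `τ_{i₁} ⋯ τ_{i_n}` of the space
that meets `C`. On the attractor the pieces shrink, so `D` may be a small thickening of a closed set
`C`, and letting it shrink to `C` gives `m_f(C) ≤ m'_f(C)`; on the sequence space the pieces are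
cylinders, so `D = C` is allowed for any measurable cylinder `C`. By symmetry the measures agree on
a generating π-system.

The same comparison for scalar multiples of measures identifies the image of `P` under `π` with `μ`
on `X`. This requires that `μ` give mass zero to the complement of `X`, which holds because the
integral of the distance to `X` is finite and is multiplied by at most the contraction ratio under
the self-similarity.
-/

noncomputable section

/-! ### Self-similar families of measures -/

section SelfSimilar

variable {X κ ι : Type*}

/-- The composition `τ_{i₁} ∘ ⋯ ∘ τ_{i_n}` along a finite word `[i₁, …, i_n]`. -/
def iterMap (τ : κ → X → X) : List κ → X → X
  | [] => id
  | i :: w => τ i ∘ iterMap τ w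

/-- Two families of measures which satisfy the same self-similarity relation and have the same
masses are comparable, `m₁ f C ≤ m₂ f D`, as soon as `D` contains every level-`n` piece of the
space that meets `C`. -/
theorem measure_le_of_pieces_subset [Fintype κ] [MeasurableSpace X] {τ : κ → X → X}
    (hτ : ∀ i, Measurable (τ i)) {F : κ → ι → ι} {m₁ m₂ : ι → Measure X}
    (h₁ : ∀ f Δ, MeasurableSet Δ → m₁ f Δ = ∑ i, m₁ (F i f) (τ i ⁻¹' Δ))
    (h₂ : ∀ f Δ, MeasurableSet Δ → m₂ f Δ = ∑ i, m₂ (F i f) (τ i ⁻¹' Δ))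
    (huniv : ∀ f, m₁ f univ = m₂ f univ) (n : ℕ) :
    ∀ C D : Set X, MeasurableSet C → MeasurableSet D →
      (∀ w : List κ, w.length = n → (range (iterMap τ w) ∩ C).Nonempty →
        range (iterMap τ w) ⊆ D) → ∀ f, m₁ f C ≤ m₂ f D := by
  induction n with
  | zero =>
    intro C D _ _ h f
    rcases C.eq_empty_or_nonempty with rfl | hne
    · simp
    · have hD : D = univ := by
        refine univ_subset_iff.1 ?_
        simpa [iterMap, hne] using h [] rfl
      rw [hD, ← huniv f]
      exact measure_mono (subset_univ _)
  | succ n ih =>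
    intro C D hC hD h f
    rw [h₁ f C hC, h₂ f D hD]
    refine Finset.sum_le_sum fun i _ => ih _ _ (hτ i hC) (hτ i hD) ?_ _
    rintro w hw ⟨_, ⟨x, rfl⟩, hx⟩
    have hsub := h (i :: w) (by simp [hw]) ⟨_, ⟨x, rfl⟩, hx⟩
    rintro _ ⟨y, rfl⟩
    exact hsub ⟨y, rfl⟩

theorem lipschitzWith_iterMap [PseudoEMetricSpace X] {τ : κ → X → X} {r : ℝ≥0}
    (hτ : ∀ i, LipschitzWith r (τ i)) (w : List κ) :
    LipschitzWith (r ^ w.length) (iterMap τ w) := by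
  induction w with
  | nil => simpa [iterMap] using LipschitzWith.id
  | cons i w ih =>
    rw [List.length_cons, pow_succ']
    exact (hτ i).comp ih

/-- On a bounded space with contracting maps, the level-`n` pieces are eventually small, so the
masses of a closed set are squeezed between those of its thickenings. -/
theorem measure_eq_of_selfSimilar_of_contracting [Fintype κ] [PseudoMetricSpace X]
    [BoundedSpace X] [MeasurableSpace X] [BorelSpace X] {τ : κ → X → X} {r : ℝ≥0} (hr : r < 1)
    (hτ : ∀ i, LipschitzWith r (τ i)) {F : κ → ι → ι} {m₁ m₂ : ι → Measure X}
    [∀ f, IsFiniteMeasure (m₁ f)]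
    (h₁ : ∀ f Δ, MeasurableSet Δ → m₁ f Δ = ∑ i, m₁ (F i f) (τ i ⁻¹' Δ))
    (h₂ : ∀ f Δ, MeasurableSet Δ → m₂ f Δ = ∑ i, m₂ (F i f) (τ i ⁻¹' Δ))
    (huniv : ∀ f, m₁ f univ = m₂ f univ) (f : ι) : m₁ f = m₂ f := by
  have hfin₂ : ∀ f, IsFiniteMeasure (m₂ f) := fun f => ⟨by rw [← huniv f]; exact measure_lt_top _ _⟩
  have hτm : ∀ i, Measurable (τ i) := fun i => (hτ i).continuous.measurable
  have hsmall : ∀ δ > 0, ∃ n : ℕ, ∀ w : List κ, w.length = n → ∀ x y : X,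
      dist (iterMap τ w x) (iterMap τ w y) < δ := by
    intro δ hδ
    have hlim : Filter.Tendsto (fun n : ℕ => (r : ℝ) ^ n * Metric.diam (univ : Set X))
        Filter.atTop (nhds (0 * Metric.diam (univ : Set X))) :=
      (tendsto_pow_atTop_nhds_zero_of_lt_one r.2 (by exact_mod_cast hr)).mul_const _
    rw [zero_mul] at hlim
    obtain ⟨n, hn⟩ := (hlim.eventually (gt_mem_nhds hδ)).exists
    refine ⟨n, fun w hw x y => lt_of_le_of_lt ?_ hn⟩
    have h := (lipschitzWith_iterMap hτ w).dist_le_mul x y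
    rw [hw] at h
    push_cast at h
    exact h.trans (mul_le_mul_of_nonneg_left (Metric.dist_le_diam_of_mem
      (Bornology.isBounded_univ.2 inferInstance) (mem_univ _) (mem_univ _)) (by positivity))
  have key : ∀ {k₁ k₂ : ι → Measure X}, (∀ f, IsFiniteMeasure (k₂ f)) →
      (∀ f Δ, MeasurableSet Δ → k₁ f Δ = ∑ i, k₁ (F i f) (τ i ⁻¹' Δ)) →
      (∀ f Δ, MeasurableSet Δ → k₂ f Δ = ∑ i, k₂ (F i f) (τ i ⁻¹' Δ)) →
      (∀ f, k₁ f univ = k₂ f univ) → ∀ C : Set X, IsClosed C → k₁ f C ≤ k₂ f C := by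
    intro k₁ k₂ hk hk₁ hk₂ hk' C hC
    refine ge_of_tendsto (tendsto_measure_thickening_of_isClosed
      ⟨1, one_pos, measure_ne_top _ _⟩ hC) ?_
    filter_upwards [self_mem_nhdsWithin] with δ hδ
    obtain ⟨n, hn⟩ := hsmall δ hδ
    refine measure_le_of_pieces_subset hτm hk₁ hk₂ hk' n C _ hC.measurableSet
      Metric.isOpen_thickening.measurableSet ?_ f
    rintro w hw ⟨_, ⟨x, rfl⟩, hx⟩ _ ⟨y, rfl⟩
    exact Metric.mem_thickening_iff.2 ⟨_, hx, hn w hw y x⟩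
  refine ext_of_generate_finite {C | IsClosed C}
    ((BorelSpace.measurable_eq).trans borel_eq_generateFrom_isClosed) isPiSystem_isClosed
    (fun C hC => le_antisymm (key hfin₂ h₁ h₂ huniv C hC)
      (key (fun f => inferInstance) h₂ h₁ (fun f => (huniv f).symm) C hC)) (huniv f)

theorem iterMap_prepend_apply {N : ℕ} (w : List (Fin N)) (α β : SeqSpace N) (k : ℕ)
    (hk : k < w.length) : iterMap prepend w α k = iterMap prepend w β k := by
  induction w generalizing k with
  | nil => simp at hk
  | cons i w ih =>
    cases k with
    | zero => rfl
    | succ k => exact ih k (by simpa using hk)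

/-- On the sequence space the level-`n` pieces are the cylinders of length `n`, and every
measurable cylinder is a union of such pieces for large `n`. -/
theorem measure_eq_of_selfSimilar_prepend {N : ℕ} {F : Fin N → ι → ι}
    {m₁ m₂ : ι → Measure (SeqSpace N)} [∀ f, IsFiniteMeasure (m₁ f)]
    (h₁ : ∀ f Δ, MeasurableSet Δ → m₁ f Δ = ∑ i, m₁ (F i f) (prepend i ⁻¹' Δ))
    (h₂ : ∀ f Δ, MeasurableSet Δ → m₂ f Δ = ∑ i, m₂ (F i f) (prepend i ⁻¹' Δ))
    (huniv : ∀ f, m₁ f univ = m₂ f univ) (f : ι) : m₁ f = m₂ f := by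
  refine ext_of_generate_finite (measurableCylinders fun _ : ℕ => Fin N)
    generateFrom_measurableCylinders.symm isPiSystem_measurableCylinders ?_ (huniv f)
  intro C hC
  have hCm : MeasurableSet C := .of_mem_measurableCylinders hC
  obtain ⟨s, S, -, rfl⟩ := (mem_measurableCylinders C).1 hC
  have hpieces : ∀ w : List (Fin N), w.length = s.sup id + 1 →
      (range (iterMap prepend w) ∩ cylinder s S).Nonempty →
        range (iterMap prepend w) ⊆ cylinder s S := by
    rintro w hw ⟨_, ⟨α, rfl⟩, hα⟩ _ ⟨β, rfl⟩
    rw [mem_cylinder] at hα ⊢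
    convert hα using 1
    funext k
    exact iterMap_prepend_apply w β α k
      (hw ▸ Nat.lt_succ_of_le (Finset.le_sup (f := id) k.2))
  exact le_antisymm
    (measure_le_of_pieces_subset measurable_prepend h₁ h₂ huniv _ _ _ hCm hCm hpieces f)
    (measure_le_of_pieces_subset measurable_prepend h₂ h₁ (fun f => (huniv f).symm) _ _ _
      hCm hCm hpieces f)

end SelfSimilar

/-! ### Positive operator-valued measures and their scalar measures -/

section POVM

variable {X H : Type*} [MeasurableSpace X] [NormedAddCommGroup H] [InnerProductSpace ℂ H]
  [CompleteSpace H]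

theorem IsPVM.isPOVM {E : MSet X → H →L[ℂ] H} (hE : IsPVM E) : IsPOVM E where
  isPositive Δ := by
    rw [← ContinuousLinearMap.nonneg_iff_isPositive]
    exact (hE.isProjection Δ).nonneg
  empty := hE.empty
  univ := hE.univ
  iUnion := hE.iUnion

/-- The finite measure `Δ ↦ ⟪f, A(Δ) f⟫`. -/
def IsPOVM.measure {A : MSet X → H →L[ℂ] H} (hA : IsPOVM A) (f : H) : Measure X :=
  Measure.ofMeasurable (fun s hs => ENNReal.ofReal (RCLike.re ⟪f, A ⟨s, hs⟩ f⟫_ℂ))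
    (by rw [hA.empty]; simp)
    (by
      intro Δ hΔ hdisj
      have h : HasSum (fun n => RCLike.re ⟪f, A ⟨Δ n, hΔ n⟩ f⟫_ℂ)
          (RCLike.re ⟪f, A ⟨⋃ n, Δ n, MeasurableSet.iUnion hΔ⟩ f⟫_ℂ) :=
        RCLike.hasSum_re ℂ (hA.iUnion (fun n => ⟨Δ n, hΔ n⟩) hdisj f f)
      rw [← h.tsum_eq, ENNReal.ofReal_tsum_of_nonneg
        (fun n => (hA.isPositive _).re_inner_nonneg_right f) h.summable])

theorem IsPOVM.measure_apply {A : MSet X → H →L[ℂ] H} (hA : IsPOVM A) (f : H) {Δ : Set X}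
    (hΔ : MeasurableSet Δ) :
    hA.measure f Δ = ENNReal.ofReal (RCLike.re ⟪f, A ⟨Δ, hΔ⟩ f⟫_ℂ) :=
  Measure.ofMeasurable_apply Δ hΔ

theorem IsPOVM.measure_univ {A : MSet X → H →L[ℂ] H} (hA : IsPOVM A) (f : H) :
    hA.measure f Set.univ = ENNReal.ofReal (RCLike.re ⟪f, f⟫_ℂ) := by
  rw [hA.measure_apply f MeasurableSet.univ, hA.univ]
  rfl

instance IsPOVM.isFiniteMeasure_measure {A : MSet X → H →L[ℂ] H} (hA : IsPOVM A) (f : H) :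
    IsFiniteMeasure (hA.measure f) :=
  ⟨by rw [hA.measure_univ]; exact ENNReal.ofReal_lt_top⟩

theorem IsPOVM.eq_of_measure_eq {A B : MSet X → H →L[ℂ] H} (hA : IsPOVM A) (hB : IsPOVM B)
    (h : ∀ f, hA.measure f = hB.measure f) : A = B := by
  funext Δ
  refine ContinuousLinearMap.coe_injective ((ext_inner_map _ _).1 fun f => ?_)
  have h' := congrArg (fun m => m Δ.1) (h f)
  simp only [hA.measure_apply f Δ.2, hB.measure_apply f Δ.2] at h'
  rw [ENNReal.ofReal_eq_ofReal_iff ((hA.isPositive _).re_inner_nonneg_right f)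
    ((hB.isPositive _).re_inner_nonneg_right f)] at h'
  have hA' := ((ContinuousLinearMap.isPositive_iff_complex _).1 (hA.isPositive Δ) f).1
  have hB' := ((ContinuousLinearMap.isPositive_iff_complex _).1 (hB.isPositive Δ) f).1
  rw [ContinuousLinearMap.coe_coe, ContinuousLinearMap.coe_coe, ← hA', ← hB',
    inner_re_symm (𝕜 := ℂ) (A Δ f) f, inner_re_symm (𝕜 := ℂ) (B Δ f) f, h']

/-- A fixed-point equation `A(Δ) = ∑ i, T_i A(τ_i⁻¹(Δ)) T_i*` makes the scalar measures of `A`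
a self-similar family. -/
theorem IsPOVM.measure_selfSimilar {κ : Type*} [Fintype κ] {τ : κ → X → X}
    (hτ : ∀ i, Measurable (τ i)) {T : κ → H →L[ℂ] H} {A : MSet X → H →L[ℂ] H} (hA : IsPOVM A)
    (hfix : ∀ Δ, A Δ = ∑ i, T i ∘L A (Δ.preimage (hτ i)) ∘L ContinuousLinearMap.adjoint (T i))
    (f : H) (Δ : Set X) (hΔ : MeasurableSet Δ) :
    hA.measure f Δ =
      ∑ i, hA.measure (ContinuousLinearMap.adjoint (T i) f) (τ i ⁻¹' Δ) := by
  simp_rw [fun i => hA.measure_apply (ContinuousLinearMap.adjoint (T i) f) (hτ i hΔ)]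
  rw [hA.measure_apply f hΔ, hfix, ← ENNReal.ofReal_sum_of_nonneg
    fun i _ => (hA.isPositive _).re_inner_nonneg_right _]
  congr 1
  rw [sum_apply, inner_sum, map_sum]
  refine Finset.sum_congr rfl fun i _ => ?_
  rw [ContinuousLinearMap.adjoint_inner_left]
  rfl

/-- The compression of a POVM by an isometry is a POVM. -/
theorem IsPOVM.compress {K : Type*} [NormedAddCommGroup K] [InnerProductSpace ℂ K]
    [CompleteSpace K] {A : MSet X → H →L[ℂ] H} (hA : IsPOVM A) (V : K →ₗᵢ[ℂ] H) :
    IsPOVM fun Δ => ContinuousLinearMap.adjoint V.toContinuousLinearMap ∘L A Δ ∘L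
      V.toContinuousLinearMap where
  isPositive Δ := (hA.isPositive Δ).adjoint_conj _
  empty := by rw [hA.empty]; simp
  univ := by
    rw [hA.univ]
    ext1 f
    refine ext_inner_left ℂ fun g => ?_
    simp
  iUnion Δ hΔ g h := by
    simpa [ContinuousLinearMap.adjoint_inner_right] using hA.iUnion Δ hΔ (V g) (V h)

/-- The image of a PVM under a measurable map is a PVM. -/
theorem IsPVM.map {Z : Type*} [MeasurableSpace Z] {E : MSet X → H →L[ℂ] H} (hE : IsPVM E)
    {p : X → Z} (hp : Measurable p) : IsPVM fun Δ : MSet Z => E (Δ.preimage hp) where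
  isProjection Δ := hE.isProjection _
  empty := hE.empty
  univ := hE.univ
  inter Δ₁ Δ₂ := hE.inter (Δ₁.preimage hp) (Δ₂.preimage hp)
  iUnion Δ hΔ g h := by
    have := hE.iUnion (fun n => (Δ n).preimage hp)
      (fun m n hmn => (hΔ hmn).preimage p) g h
    convert this using 4
    exact Subtype.ext preimage_iUnion

end POVM

/-! ### Multiplication by indicator functions -/

section Multiplication

variable {α : Type*} [MeasurableSpace α]

theorem inner_indicatorL2 (μ : Measure α) {s : Set α} (hs : MeasurableSet s) (h g : Lp ℂ 2 μ) :
    ⟪h, indicatorL2 μ hs g⟫_ℂ = ∫ x in s, ⟪h x, g x⟫_ℂ ∂μ := by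
  rw [L2.inner_def, ← integral_indicator hs]
  refine integral_congr_ae ?_
  filter_upwards [coeFn_indicatorL2 μ hs g] with x hx
  rw [hx]
  by_cases hxs : x ∈ s <;> simp [hxs]

theorem indicatorL2_comp_indicatorL2 (μ : Measure α) {s t : Set α} (hs : MeasurableSet s)
    (ht : MeasurableSet t) :
    indicatorL2 μ (hs.inter ht) = indicatorL2 μ hs ∘L indicatorL2 μ ht := by
  ext1 φ
  refine Lp.ext ?_
  filter_upwards [coeFn_indicatorL2 μ (hs.inter ht) φ, coeFn_indicatorL2 μ ht φ,
    coeFn_indicatorL2 μ hs (indicatorL2 μ ht φ)] with x h1 h2 h3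
  rw [h1, ContinuousLinearMap.comp_apply, h3, ← indicator_indicator]
  by_cases hx : x ∈ s <;> simp [hx, h2]

theorem isSelfAdjoint_indicatorL2 (μ : Measure α) {s : Set α} (hs : MeasurableSet s) :
    IsSelfAdjoint (indicatorL2 μ hs) := by
  rw [ContinuousLinearMap.isSelfAdjoint_iff_isSymmetric]
  intro f g
  rw [ContinuousLinearMap.coe_coe, inner_indicatorL2, ← inner_conj_symm, inner_indicatorL2,
    ← integral_conj]
  simp_rw [inner_conj_symm]

/-- Multiplication by indicator functions is a projection-valued measure. -/
theorem isPVM_indicatorL2 (μ : Measure α) : IsPVM fun Δ : MSet α => indicatorL2 μ Δ.2 where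
  isProjection Δ := ⟨by
    have h := indicatorL2_comp_indicatorL2 μ Δ.2 Δ.2
    simp only [inter_self] at h
    exact h.symm, isSelfAdjoint_indicatorL2 μ Δ.2⟩
  empty := by
    ext1 g
    refine ext_inner_left ℂ fun h => ?_
    simp [inner_indicatorL2]
  univ := by
    ext1 g
    refine ext_inner_left ℂ fun h => ?_
    rw [inner_indicatorL2, Measure.restrict_univ, ← L2.inner_def]
    rfl
  inter Δ₁ Δ₂ := indicatorL2_comp_indicatorL2 μ Δ₁.2 Δ₂.2
  iUnion Δ hΔ g h := by
    simp_rw [inner_indicatorL2]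
    exact hasSum_integral_iUnion (fun n => (Δ n).2) hΔ (L2.integrable_inner h g).integrableOn

end Multiplication

/-! ### The Bernoulli measure and the Cuntz isometries -/

section Bernoulli

variable {N : ℕ}

theorem isProbabilityMeasure_uniformOn_univ_fin (hN : N ≠ 0) :
    IsProbabilityMeasure (ProbabilityTheory.uniformOn (univ : Set (Fin N))) :=
  have : NeZero N := ⟨hN⟩
  ProbabilityTheory.isProbabilityMeasure_uniformOn finite_univ univ_nonempty

theorem isProbabilityMeasure_bernoulliMeasure (hN : N ≠ 0) :
    IsProbabilityMeasure (bernoulliMeasure N) := by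
  have := isProbabilityMeasure_uniformOn_univ_fin hN
  unfold bernoulliMeasure
  infer_instance

/-- Prepending a uniformly distributed letter to a Bernoulli sequence gives a Bernoulli
sequence. -/
theorem map_prepend_prod_bernoulliMeasure (hN : N ≠ 0) :
    ((ProbabilityTheory.uniformOn (univ : Set (Fin N))).prod (bernoulliMeasure N)).map
      (fun p => prepend p.1 p.2) = bernoulliMeasure N := by
  classical
  have := isProbabilityMeasure_uniformOn_univ_fin hN
  have := isProbabilityMeasure_bernoulliMeasure hN
  have hm : Measurable fun p : Fin N × SeqSpace N => prepend p.1 p.2 :=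
    measurable_from_prod_countable_right fun i => measurable_prepend i
  refine Measure.eq_infinitePi _ fun s t ht => ?_
  rw [Measure.map_apply hm (MeasurableSet.pi s.countable_toSet fun i _ => ht i)]
  have hinj : Function.Injective Nat.succ := Nat.succ_injective
  have hpre : (fun p : Fin N × SeqSpace N => prepend p.1 p.2) ⁻¹' (Set.pi s t) =
      (if 0 ∈ s then t 0 else univ) ×ˢ
        Set.pi (s.preimage Nat.succ hinj.injOn : Finset ℕ) (fun n => t (n + 1)) := by
    ext ⟨i, α⟩
    constructor
    · intro h
      refine ⟨?_, fun n hn => h (n + 1) (by simpa using hn)⟩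
      split_ifs with h0
      · exact h 0 h0
      · trivial
    · rintro ⟨h0, h1⟩ n hn
      cases n with
      | zero => rwa [if_pos (by simpa using hn)] at h0
      | succ n => exact h1 n (by simpa using hn)
  rw [hpre, Measure.prod_prod]
  conv_lhs => rw [bernoulliMeasure]
  rw [Measure.infinitePi_pi _ fun i _ => ht _]
  have hsplit := Finset.prod_preimage' Nat.succ s hinj.injOn
    (fun n => ProbabilityTheory.uniformOn (univ : Set (Fin N)) (t n))
  rw [hsplit]
  by_cases h0 : 0 ∈ s
  · rw [if_pos h0, ← Finset.mul_prod_erase s _ h0]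
    congr 1
    refine Finset.prod_congr ?_ fun _ _ => rfl
    ext n
    cases n <;> simp
  · rw [if_neg h0, measure_univ, one_mul]
    refine Finset.prod_congr (Finset.filter_true_of_mem fun n hn => ?_) fun _ _ => rfl
    cases n with
    | zero => exact absurd hn h0
    | succ n => exact ⟨n, rfl⟩

theorem bernoulliMeasure_apply (hN : N ≠ 0) {Δ : Set (SeqSpace N)} (hΔ : MeasurableSet Δ) :
    bernoulliMeasure N Δ = ∑ i, (1 / (N : ℝ≥0∞)) * bernoulliMeasure N (prepend i ⁻¹' Δ) := by
  have := isProbabilityMeasure_bernoulliMeasure hN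
  have hm : Measurable fun p : Fin N × SeqSpace N => prepend p.1 p.2 :=
    measurable_from_prod_countable_right fun i => measurable_prepend i
  conv_lhs => rw [← map_prepend_prod_bernoulliMeasure hN]
  rw [Measure.map_apply hm hΔ, Measure.prod_apply (hm hΔ), lintegral_fintype]
  refine Finset.sum_congr rfl fun i _ => ?_
  rw [ProbabilityTheory.uniformOn_univ, Measure.count_singleton, Fintype.card_fin, mul_comm]
  rfl

theorem restrict_range_prepend (i : Fin N) :
    (bernoulliMeasure N).restrict (range (prepend i)) =
      (1 / (N : ℝ≥0∞)) • (bernoulliMeasure N).map (prepend i) := by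
  have hN : N ≠ 0 := i.pos.ne'
  ext Δ hΔ
  rw [Measure.restrict_apply hΔ, bernoulliMeasure_apply hN (hΔ.inter
    (measurableSet_range_prepend i)), Finset.sum_eq_single i, Measure.smul_apply,
    Measure.map_apply (measurable_prepend i) hΔ, preimage_inter, preimage_range, inter_univ]
  · rfl
  · intro j _ hj
    have : prepend j ⁻¹' (Δ ∩ range (prepend i)) = ∅ := by
      refine eq_empty_of_forall_notMem fun α hα => hj ?_
      have h := hα.2
      rw [range_prepend] at h
      exact h
    rw [this, measure_empty, mul_zero]
  · simp

theorem map_prepend_le (i : Fin N) :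
    (bernoulliMeasure N).map (prepend i) ≤ (N : ℝ≥0) • bernoulliMeasure N := by
  have hN : (N : ℝ≥0∞) ≠ 0 := by exact_mod_cast i.pos.ne'
  have h : (bernoulliMeasure N).map (prepend i) =
      (N : ℝ≥0∞) • (bernoulliMeasure N).restrict (range (prepend i)) := by
    rw [restrict_range_prepend, smul_smul, one_div,
      ENNReal.mul_inv_cancel hN (ENNReal.natCast_ne_top N), one_smul]
  rw [h]
  refine Measure.le_iff'.2 fun s => ?_
  change (N : ℝ≥0∞) * _ ≤ ((N : ℝ≥0) : ℝ≥0∞) * _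
  rw [ENNReal.coe_natCast]
  gcongr
  exact Measure.restrict_le_self

theorem integral_range_prepend (i : Fin N) {g : SeqSpace N → ℂ}
    (hg : AEStronglyMeasurable g (bernoulliMeasure N)) :
    ∫ x in range (prepend i), g x ∂bernoulliMeasure N =
      ((N : ℂ))⁻¹ * ∫ x, g (prepend i x) ∂bernoulliMeasure N := by
  rw [restrict_range_prepend, integral_smul_measure, integral_map
    (measurable_prepend i).aemeasurable
    (hg.mono_ac (quasiMeasurePreserving_of_map_le (measurable_prepend i)
      (map_prepend_le i)).absolutelyContinuous)]
  simp [Complex.real_smul]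

theorem coeFn_cuntzT (i : Fin N) (φ : Lp ℂ 2 (bernoulliMeasure N)) :
    cuntzT i φ =ᵐ[bernoulliMeasure N]
      fun x => (Real.sqrt N : ℂ) * (range (prepend i)).indicator (fun x => φ (shift x)) x := by
  have hc : (bernoulliMeasure N).map shift ≤ (1 : ℝ≥0) • bernoulliMeasure N := by
    rw [one_smul, map_shift_bernoulliMeasure]
  have h : cuntzT i φ = ((Real.sqrt N : ℝ) : ℂ) • indicatorL2 (bernoulliMeasure N)
    (measurableSet_range_prepend i) (compL2 (c := 1) measurable_shift hc φ) := rfl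
  rw [h]
  filter_upwards [Lp.coeFn_smul ((Real.sqrt N : ℝ) : ℂ) (indicatorL2 (bernoulliMeasure N)
    (measurableSet_range_prepend i) (compL2 (c := 1) measurable_shift hc φ)),
    coeFn_indicatorL2 (bernoulliMeasure N) (measurableSet_range_prepend i)
      (compL2 (c := 1) measurable_shift hc φ),
    coeFn_compL2 (c := 1) measurable_shift hc φ] with x h1 h2 h3
  rw [h1, Pi.smul_apply, h2, smul_eq_mul]
  by_cases hx : x ∈ range (prepend i)
  · rw [indicator_of_mem hx, indicator_of_mem hx, h3]
    rfl
  · rw [indicator_of_notMem hx, indicator_of_notMem hx]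

/-- `T_i* φ = (1 / √N) (φ ∘ η_i)`. -/
theorem adjoint_cuntzT (i : Fin N) :
    ContinuousLinearMap.adjoint (cuntzT i) =
      ((1 / Real.sqrt N : ℝ) : ℂ) • compL2 (measurable_prepend i) (map_prepend_le i) := by
  symm
  rw [ContinuousLinearMap.eq_adjoint_iff]
  intro φ ψ
  have hN : (0 : ℝ) < N := by exact_mod_cast i.pos
  have hsqrt : (Real.sqrt N : ℂ) ≠ 0 := by exact_mod_cast (Real.sqrt_pos.2 hN).ne'
  have hsq : (Real.sqrt N : ℂ) * (Real.sqrt N : ℂ) = N := by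
    exact_mod_cast Real.mul_self_sqrt hN.le
  have hc : (bernoulliMeasure N).map shift ≤ (1 : ℝ≥0) • bernoulliMeasure N := by
    rw [one_smul, map_shift_bernoulliMeasure]
  have hmeas : AEStronglyMeasurable (fun x => ⟪φ x, ψ (shift x)⟫_ℂ) (bernoulliMeasure N) :=
    (Lp.aestronglyMeasurable φ).inner
      (memLp_comp_of_map_le (c := 1) measurable_shift hc ψ).aestronglyMeasurable
  have hR : ⟪φ, cuntzT i ψ⟫_ℂ =
      Real.sqrt N * ∫ x in range (prepend i), ⟪φ x, ψ (shift x)⟫_ℂ ∂bernoulliMeasure N := by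
    rw [L2.inner_def, ← integral_indicator (measurableSet_range_prepend i),
      ← integral_const_mul]
    refine integral_congr_ae ?_
    filter_upwards [coeFn_cuntzT i ψ] with x hx
    rw [hx]
    by_cases hxs : x ∈ range (prepend i)
    · rw [indicator_of_mem hxs, indicator_of_mem hxs, ← smul_eq_mul, inner_smul_right]
    · rw [indicator_of_notMem hxs, indicator_of_notMem hxs, mul_zero, inner_zero_right]
  rw [hR, integral_range_prepend i hmeas, smul_apply, inner_smul_left,
    Complex.conj_ofReal, L2.inner_def, ← mul_assoc]
  congr 1
  · rw [← hsq]
    push_cast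
    field_simp
  · refine integral_congr_ae ?_
    filter_upwards [coeFn_compL2 (measurable_prepend i) (map_prepend_le i) φ] with x hx
    rw [hx]
    rfl

theorem prepend_shift_of_mem_range {i : Fin N} {α : SeqSpace N} (h : α ∈ range (prepend i)) :
    prepend i (shift α) = α := by
  obtain ⟨β, rfl⟩ := h
  rfl

theorem coeFn_adjoint_cuntzT (i : Fin N) (φ : Lp ℂ 2 (bernoulliMeasure N)) :
    ContinuousLinearMap.adjoint (cuntzT i) φ =ᵐ[bernoulliMeasure N]
      fun x => (Real.sqrt N : ℂ)⁻¹ * φ (prepend i x) := by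
  rw [adjoint_cuntzT, smul_apply]
  filter_upwards [Lp.coeFn_smul ((1 / Real.sqrt N : ℝ) : ℂ)
    (compL2 (measurable_prepend i) (map_prepend_le i) φ),
    coeFn_compL2 (measurable_prepend i) (map_prepend_le i) φ] with x h1 h2
  rw [h1, Pi.smul_apply, h2]
  simp

theorem cuntzT_comp_indicatorL2_comp_adjoint (i : Fin N) {Δ : Set (SeqSpace N)}
    (hΔ : MeasurableSet Δ) :
    cuntzT i ∘L indicatorL2 (bernoulliMeasure N) (measurable_prepend i hΔ) ∘L
      ContinuousLinearMap.adjoint (cuntzT i) =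
        indicatorL2 (bernoulliMeasure N) (hΔ.inter (measurableSet_range_prepend i)) := by
  have hN : (0 : ℝ) < N := by exact_mod_cast i.pos
  have hsqrt : (Real.sqrt N : ℂ) ≠ 0 := by exact_mod_cast (Real.sqrt_pos.2 hN).ne'
  have hq : Measure.QuasiMeasurePreserving shift (bernoulliMeasure N) (bernoulliMeasure N) :=
    ⟨measurable_shift, by rw [map_shift_bernoulliMeasure]⟩
  ext1 φ
  refine Lp.ext ?_
  filter_upwards [coeFn_cuntzT i (indicatorL2 (bernoulliMeasure N) (measurable_prepend i hΔ)
      (ContinuousLinearMap.adjoint (cuntzT i) φ)),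
    hq.ae_eq_comp (coeFn_indicatorL2 (bernoulliMeasure N) (measurable_prepend i hΔ)
      (ContinuousLinearMap.adjoint (cuntzT i) φ)),
    hq.ae_eq_comp (coeFn_adjoint_cuntzT i φ),
    coeFn_indicatorL2 (bernoulliMeasure N) (hΔ.inter (measurableSet_range_prepend i)) φ]
    with x h1 h2 h3 h4
  rw [h4, ContinuousLinearMap.comp_apply, ContinuousLinearMap.comp_apply, h1]
  by_cases hx : x ∈ range (prepend i)
  · have hps := prepend_shift_of_mem_range hx
    simp only [Function.comp_apply] at h2 h3
    rw [indicator_of_mem hx, h2]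
    by_cases hxΔ : x ∈ Δ
    · rw [indicator_of_mem (show shift x ∈ prepend i ⁻¹' Δ by rwa [mem_preimage, hps]), h3, hps,
        indicator_of_mem (show x ∈ Δ ∩ range (prepend i) from ⟨hxΔ, hx⟩),
        mul_inv_cancel_left₀ hsqrt]
    · rw [indicator_of_notMem (show shift x ∉ prepend i ⁻¹' Δ by rwa [mem_preimage, hps]),
        indicator_of_notMem (fun h => hxΔ h.1), mul_zero]
  · rw [indicator_of_notMem hx, indicator_of_notMem (fun h => hx h.2), mul_zero]

/-- Multiplication by indicator functions solves `E(·) = ∑ i, T_i E(η_i⁻¹(·)) T_i*`, because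
the ranges of the `η_i` partition the sequence space. -/
theorem isCuntzFixed_indicatorL2 :
    IsCuntzFixed fun Δ : MSet (SeqSpace N) => indicatorL2 (bernoulliMeasure N) Δ.2 := by
  intro Δ
  have h : ∀ i : Fin N, cuntzT i ∘L indicatorL2 (bernoulliMeasure N)
      (Δ.preimage (measurable_prepend i)).2 ∘L ContinuousLinearMap.adjoint (cuntzT i) =
        indicatorL2 (bernoulliMeasure N) (Δ.2.inter (measurableSet_range_prepend i)) :=
    fun i => cuntzT_comp_indicatorL2_comp_adjoint i Δ.2
  simp_rw [h]
  ext1 g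
  refine ext_inner_left ℂ fun f => ?_
  rw [sum_apply, inner_sum]
  simp_rw [inner_indicatorL2]
  rw [← integral_iUnion_fintype (fun i => Δ.2.inter (measurableSet_range_prepend i)) ?_
    (fun i => (L2.integrable_inner f g).integrableOn)]
  · congr 2
    ext x
    simp [range_prepend]
  · intro i j hij
    refine Set.disjoint_left.2 fun x hx hx' => hij ?_
    have h1 := hx.2
    have h2 := hx'.2
    rw [range_prepend] at h1 h2
    exact Eq.trans (Eq.symm h1) h2

theorem IsCuntzFixed.eq_of_isPVM
    {E E' : MSet (SeqSpace N) → Lp ℂ 2 (bernoulliMeasure N) →L[ℂ] Lp ℂ 2 (bernoulliMeasure N)}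
    (hfix : IsCuntzFixed E) (hE : IsPVM E) (hfix' : IsCuntzFixed E') (hE' : IsPVM E') :
    E = E' :=
  hE.isPOVM.eq_of_measure_eq hE'.isPOVM fun f =>
    measure_eq_of_selfSimilar_prepend
      (fun f => hE.isPOVM.measure_selfSimilar measurable_prepend hfix f)
      (fun f => hE'.isPOVM.measure_selfSimilar measurable_prepend hfix' f)
      (fun f => by rw [hE.isPOVM.measure_univ, hE'.isPOVM.measure_univ]) f

end Bernoulli

/-! ### The Hutchinson measure as the image of the Bernoulli measure -/

namespace IFS

variable {Y : Type*} [MetricSpace Y] {N : ℕ} {S : IFS Y N} {X : Set Y}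

/-- The coding map intertwines `η_i` and `σ_i`. -/
theorem IsAttractor.coding_prepend (hX : S.IsAttractor X) (i : Fin N) (α : SeqSpace N) :
    hX.coding (prepend i α) = hX.restrict i (hX.coding α) := by
  have hα : (hX.coding α : Y) ∈ ⋂ n : ℕ, S.word α (n + 1) '' X := by
    rw [hX.iInter_word]
    exact mem_singleton _
  have h : S.map i (hX.coding α) ∈ ⋂ n : ℕ, S.word (prepend i α) (n + 1) '' X := by
    refine mem_iInter.2 fun n => ?_
    have hn : (hX.coding α : Y) ∈ S.word α n '' X := by
      cases n with
      | zero => simp [word]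
      | succ n => exact mem_iInter.1 hα n
    obtain ⟨u, hu, hu'⟩ := hn
    exact ⟨u, hu, congrArg (S.map i) hu'⟩
  rw [hX.iInter_word] at h
  exact Subtype.ext (mem_singleton_iff.1 h).symm

theorem IsAttractor.lipschitzWith_restrict (hX : S.IsAttractor X) {r : ℝ≥0}
    (hr : ∀ i, LipschitzWith r (S.map i)) (i : Fin N) : LipschitzWith r (hX.restrict i) :=
  fun x y => hr i x y

theorem IsHutchinsonMeasure.ne_zero [MeasurableSpace Y] {μ : Measure Y}
    (hμ : S.IsHutchinsonMeasure μ) : N ≠ 0 := by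
  rintro rfl
  have := hμ.isProbabilityMeasure
  have h := hμ.fixed univ MeasurableSet.univ
  simp at h

variable [MeasurableSpace Y] [BorelSpace Y] {μ : Measure Y}

theorem IsHutchinsonMeasure.eq_sum_map (hμ : S.IsHutchinsonMeasure μ) :
    μ = ∑ i, (1 / (N : ℝ≥0∞)) • μ.map (S.map i) := by
  ext Δ hΔ
  rw [hμ.fixed Δ hΔ, Measure.finsetSum_apply]
  refine Finset.sum_congr rfl fun i _ => ?_
  rw [Measure.smul_apply, Measure.map_apply (S.continuous_map i).measurable hΔ, smul_eq_mul]

/-- The Hutchinson measure is carried by the attractor: the integral of the distance to `X` is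
finite and is contracted by the self-similarity, hence it vanishes. -/
theorem IsHutchinsonMeasure.measure_compl_attractor (hμ : S.IsHutchinsonMeasure μ)
    (hX : S.IsAttractor X) : μ Xᶜ = 0 := by
  have := hμ.isProbabilityMeasure
  obtain ⟨r, hr1, hr⟩ := S.exists_ratio
  have hN := hμ.ne_zero
  have hmeas : Measurable fun y : Y => Metric.infEDist y X := Metric.continuous_infEDist.measurable
  have hcontr : ∀ i y, Metric.infEDist (S.map i y) X ≤ r * Metric.infEDist y X := by
    intro i y
    obtain ⟨x, hx, hyx⟩ := hX.isCompact.exists_infEDist_eq_edist hX.nonempty y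
    rw [hyx]
    exact (Metric.infEDist_le_edist_of_mem (hX.map_mem i hx)).trans (hr i y x)
  have hfin : ∫⁻ y, Metric.infEDist y X ∂μ ≠ ∞ := by
    have hint := (hμ.integrable (fun y => Metric.infDist y X)
      ⟨1, Metric.lipschitz_infDist_pt X⟩).lintegral_lt_top
    refine (lt_of_eq_of_lt (lintegral_congr fun y => ?_) hint).ne
    rw [Metric.infDist, ENNReal.ofReal_toReal (Metric.infEDist_ne_top hX.nonempty)]
  have hle : ∫⁻ y, Metric.infEDist y X ∂μ ≤ r * ∫⁻ y, Metric.infEDist y X ∂μ := by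
    conv_lhs => rw [hμ.eq_sum_map]
    rw [lintegral_finsetSum_measure]
    calc ∑ i, ∫⁻ y, Metric.infEDist y X ∂((1 / (N : ℝ≥0∞)) • μ.map (S.map i))
        ≤ ∑ _i : Fin N, (1 / (N : ℝ≥0∞)) * (r * ∫⁻ y, Metric.infEDist y X ∂μ) := by
          refine Finset.sum_le_sum fun i _ => ?_
          rw [lintegral_smul_measure, lintegral_map hmeas (S.continuous_map i).measurable,
            ← lintegral_const_mul _ hmeas, smul_eq_mul]
          gcongr
          exact hcontr i _
      _ = r * ∫⁻ y, Metric.infEDist y X ∂μ := by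
          rw [Finset.sum_const, Finset.card_univ, Fintype.card_fin, nsmul_eq_mul, ← mul_assoc,
            one_div, ENNReal.mul_inv_cancel (by exact_mod_cast hN) (ENNReal.natCast_ne_top N),
            one_mul]
  have hzero : ∫⁻ y, Metric.infEDist y X ∂μ = 0 := by
    by_contra h0
    have hlt : (r : ℝ≥0∞) * ∫⁻ y, Metric.infEDist y X ∂μ < 1 * ∫⁻ y, Metric.infEDist y X ∂μ :=
      ENNReal.mul_lt_mul_left h0 hfin (by exact_mod_cast hr1)
    rw [one_mul] at hlt
    exact absurd hle (not_le.2 hlt)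
  rw [lintegral_eq_zero_iff hmeas] at hzero
  have hnull : μ {y | ¬ Metric.infEDist y X = 0} = 0 := ae_iff.1 hzero
  refine measure_mono_null (t := {y | ¬ Metric.infEDist y X = 0}) (fun y hy h => hy ?_) hnull
  rw [← hX.isCompact.isClosed.closure_eq]
  exact Metric.mem_closure_iff_infEDist_zero.2 h

theorem IsHutchinsonMeasure.isProbabilityMeasure_onSubtype (hμ : S.IsHutchinsonMeasure μ)
    (hX : S.IsAttractor X) : IsProbabilityMeasure (onSubtype μ X) := by
  have := hμ.isProbabilityMeasure
  have hXm : MeasurableSet X := hX.isCompact.isClosed.measurableSet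
  constructor
  rw [comap_subtype_coe_apply hXm, image_univ, Subtype.range_coe,
    ← prob_compl_eq_zero_iff hXm, hμ.measure_compl_attractor hX]

theorem IsHutchinsonMeasure.onSubtype_apply (hμ : S.IsHutchinsonMeasure μ)
    (hX : S.IsAttractor X) {Δ : Set X} (hΔ : MeasurableSet Δ) :
    onSubtype μ X Δ = ∑ i, (1 / (N : ℝ≥0∞)) * onSubtype μ X (hX.restrict i ⁻¹' Δ) := by
  have hXm : MeasurableSet X := hX.isCompact.isClosed.measurableSet
  rw [comap_subtype_coe_apply hXm, hμ.fixed _ (hXm.subtype_image hΔ)]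
  refine Finset.sum_congr rfl fun i _ => ?_
  rw [comap_subtype_coe_apply hXm]
  congr 1
  refine measure_congr ?_
  -- Off the null set `Xᶜ` the two preimages coincide.
  filter_upwards [mem_ae_iff.2 (hμ.measure_compl_attractor hX)] with y hy
  refine propext ⟨?_, ?_⟩
  · rintro ⟨x, hx, hxy⟩
    refine ⟨⟨y, hy⟩, ?_, rfl⟩
    have : hX.restrict i ⟨y, hy⟩ = x := Subtype.ext hxy.symm
    rwa [mem_preimage, this]
  · rintro ⟨x, hx, rfl⟩
    exact ⟨hX.restrict i x, hx, rfl⟩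

/-- The coding map sends the Bernoulli measure to the Hutchinson measure: both are self-similar
probability measures on the attractor, and there is only one such measure. The scalar
self-similarity is put in the form of a family indexed by the total mass `c`, with `c` passing
to `c / N` on each piece. -/
theorem IsHutchinsonMeasure.map_coding (hμ : S.IsHutchinsonMeasure μ) (hX : S.IsAttractor X) :
    (bernoulliMeasure N).map hX.coding = onSubtype μ X := by
  obtain ⟨r, hr1, hr⟩ := S.exists_ratio
  have hN := hμ.ne_zero
  have := isProbabilityMeasure_bernoulliMeasure hN
  have hμX := hμ.isProbabilityMeasure_onSubtype hX
  have : CompactSpace X := isCompact_iff_compactSpace.1 hX.isCompact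
  have hπ : IsProbabilityMeasure ((bernoulliMeasure N).map hX.coding) :=
    Measure.isProbabilityMeasure_map hX.measurable_coding.aemeasurable
  have hselfπ : ∀ Δ : Set X, MeasurableSet Δ → (bernoulliMeasure N).map hX.coding Δ =
      ∑ i, (1 / (N : ℝ≥0∞)) * (bernoulliMeasure N).map hX.coding (hX.restrict i ⁻¹' Δ) := by
    intro Δ hΔ
    rw [Measure.map_apply hX.measurable_coding hΔ,
      bernoulliMeasure_apply hN (hX.measurable_coding hΔ)]
    refine Finset.sum_congr rfl fun i _ => ?_
    rw [Measure.map_apply hX.measurable_coding (hX.measurable_restrict i hΔ)]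
    congr 2
    ext α
    simp only [mem_preimage, hX.coding_prepend]
  have hscale : ∀ {ν : Measure X}, (∀ Δ : Set X, MeasurableSet Δ →
      ν Δ = ∑ i, (1 / (N : ℝ≥0∞)) * ν (hX.restrict i ⁻¹' Δ)) →
      ∀ (c : ℝ≥0) (Δ : Set X), MeasurableSet Δ →
        (c • ν) Δ = ∑ i : Fin N, ((c / N) • ν) (hX.restrict i ⁻¹' Δ) := by
    intro ν hν c Δ hΔ
    have hNN : ((c / N : ℝ≥0) : ℝ≥0∞) = c * (1 / (N : ℝ≥0∞)) := by
      rw [ENNReal.coe_div (by exact_mod_cast hN), ENNReal.coe_natCast, one_div, div_eq_mul_inv]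
    change (c : ℝ≥0∞) * ν Δ = ∑ i : Fin N, ((c / N : ℝ≥0) : ℝ≥0∞) * ν (hX.restrict i ⁻¹' Δ)
    rw [hν Δ hΔ, Finset.mul_sum, hNN]
    simp_rw [mul_assoc]
  have h := measure_eq_of_selfSimilar_of_contracting (ι := ℝ≥0) (F := fun _ c => c / N)
    (m₁ := fun c => c • (bernoulliMeasure N).map hX.coding) (m₂ := fun c => c • onSubtype μ X)
    hr1 (hX.lipschitzWith_restrict hr) (hscale hselfπ)
    (hscale fun Δ hΔ => hμ.onSubtype_apply hX hΔ)
    (fun c => by simp only [Measure.smul_apply, hπ.measure_univ, hμX.measure_univ]) 1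
  simpa only [one_smul] using h

theorem IsHutchinsonMeasure.measurePreserving_coding (hμ : S.IsHutchinsonMeasure μ)
    (hX : S.IsAttractor X) :
    MeasurePreserving hX.coding (bernoulliMeasure N) (onSubtype μ X) :=
  ⟨hX.measurable_coding, hμ.map_coding hX⟩

/-! ### The isometry induced by the coding map -/

/-- The isometry `V f = f ∘ π`. -/
def codingIsometry (hX : S.IsAttractor X) (hμ : S.IsHutchinsonMeasure μ) :
    Lp ℂ 2 (onSubtype μ X) →ₗᵢ[ℂ] Lp ℂ 2 (bernoulliMeasure N) :=
  Lp.compMeasurePreservingₗᵢ ℂ hX.coding (hμ.measurePreserving_coding hX)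

theorem coeFn_codingIsometry (hX : S.IsAttractor X) (hμ : S.IsHutchinsonMeasure μ)
    (f : Lp ℂ 2 (onSubtype μ X)) :
    codingIsometry hX hμ f =ᵐ[bernoulliMeasure N] f ∘ hX.coding :=
  Lp.coeFn_compMeasurePreserving f (hμ.measurePreserving_coding hX)

/-- `V F_i = T_i* V`: on functions this is `π ∘ η_i = σ_i ∘ π`. -/
theorem codingIsometry_comp_opF (hX : S.IsAttractor X) (hμ : S.IsHutchinsonMeasure μ)
    (i : Fin N) :
    (codingIsometry hX hμ).toContinuousLinearMap ∘L opF hX hμ i =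
      ContinuousLinearMap.adjoint (cuntzT i) ∘L
        (codingIsometry hX hμ).toContinuousLinearMap := by
  have hq := (hμ.measurePreserving_coding hX).quasiMeasurePreserving
  ext1 f
  refine Lp.ext ?_
  have hF : opF hX hμ i f = ((1 / Real.sqrt N : ℝ) : ℂ) •
    compL2 (hX.measurable_restrict i) (hX.map_restrict_le hμ i) f := rfl
  filter_upwards [coeFn_codingIsometry hX hμ (opF hX hμ i f),
    hq.ae_eq_comp (hF ▸ Lp.coeFn_smul ((1 / Real.sqrt N : ℝ) : ℂ)
      (compL2 (hX.measurable_restrict i) (hX.map_restrict_le hμ i) f)),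
    hq.ae_eq_comp (coeFn_compL2 (hX.measurable_restrict i) (hX.map_restrict_le hμ i) f),
    coeFn_adjoint_cuntzT i (codingIsometry hX hμ f),
    (quasiMeasurePreserving_of_map_le (measurable_prepend i) (map_prepend_le i)).ae_eq_comp
      (coeFn_codingIsometry hX hμ f)] with x h1 h2 h3 h4 h5
  simp only [Function.comp_apply, Pi.smul_apply] at h1 h2 h3 h5
  change codingIsometry hX hμ (opF hX hμ i f) x =
    ContinuousLinearMap.adjoint (cuntzT i) (codingIsometry hX hμ f) x
  rw [h1, h2, h3, h4, h5, hX.coding_prepend]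
  simp

/-! ### The fixed POVM on the attractor -/

/-- The operator-valued measure `Δ ↦ V* E(π⁻¹(Δ)) V`. -/
def compression (hX : S.IsAttractor X) (hμ : S.IsHutchinsonMeasure μ)
    (E : MSet (SeqSpace N) → Lp ℂ 2 (bernoulliMeasure N) →L[ℂ] Lp ℂ 2 (bernoulliMeasure N))
    (Δ : MSet X) : Lp ℂ 2 (onSubtype μ X) →L[ℂ] Lp ℂ 2 (onSubtype μ X) :=
  ContinuousLinearMap.adjoint (codingIsometry hX hμ).toContinuousLinearMap ∘L
    E (Δ.preimage hX.measurable_coding) ∘L (codingIsometry hX hμ).toContinuousLinearMap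

theorem isPOVM_compression (hX : S.IsAttractor X) (hμ : S.IsHutchinsonMeasure μ)
    {E : MSet (SeqSpace N) → Lp ℂ 2 (bernoulliMeasure N) →L[ℂ] Lp ℂ 2 (bernoulliMeasure N)}
    (hE : IsPVM E) : IsPOVM (compression hX hμ E) :=
  (hE.map hX.measurable_coding).isPOVM.compress (codingIsometry hX hμ)

/-- Compressing a solution of the fixed-point equation on the sequence space by `V` gives a
solution on the attractor, because `V F_i = T_i* V` and, by taking adjoints, `S_i V* = V* T_i`. -/
theorem isFixed_compression (hX : S.IsAttractor X) (hμ : S.IsHutchinsonMeasure μ)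
    {E : MSet (SeqSpace N) → Lp ℂ 2 (bernoulliMeasure N) →L[ℂ] Lp ℂ 2 (bernoulliMeasure N)}
    (hE : IsCuntzFixed E) : IsFixed hX hμ (compression hX hμ E) := by
  intro Δ
  ext1 f
  refine ext_inner_left ℂ fun g => ?_
  rw [compression, hE]
  simp only [compression, sum_apply, ContinuousLinearMap.comp_apply, inner_sum, opS,
    ContinuousLinearMap.adjoint_inner_right, ContinuousLinearMap.adjoint_adjoint, map_sum]
  refine Finset.sum_congr rfl fun i _ => ?_
  have hV : ∀ u, (codingIsometry hX hμ).toContinuousLinearMap (opF hX hμ i u) =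
      ContinuousLinearMap.adjoint (cuntzT i)
        ((codingIsometry hX hμ).toContinuousLinearMap u) := fun u =>
    DFunLike.congr_fun (codingIsometry_comp_opF hX hμ i) u
  have hΔ : (Δ.preimage hX.measurable_coding).preimage (measurable_prepend i) =
      (Δ.preimage (hX.measurable_restrict i)).preimage hX.measurable_coding := by
    refine Subtype.ext ?_
    ext α
    simp only [MSet.preimage, mem_preimage, hX.coding_prepend]
  rw [hV, hV, hΔ, ContinuousLinearMap.adjoint_inner_left]

theorem IsFixed.eq_of_isPOVM {hX : S.IsAttractor X} {hμ : S.IsHutchinsonMeasure μ}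
    {A B : MSet X → Lp ℂ 2 (onSubtype μ X) →L[ℂ] Lp ℂ 2 (onSubtype μ X)}
    (hfixA : IsFixed hX hμ A) (hA : IsPOVM A) (hfixB : IsFixed hX hμ B) (hB : IsPOVM B) :
    A = B := by
  obtain ⟨r, hr1, hr⟩ := S.exists_ratio
  have : CompactSpace X := isCompact_iff_compactSpace.1 hX.isCompact
  exact hA.eq_of_measure_eq hB fun f =>
    measure_eq_of_selfSimilar_of_contracting hr1 (hX.lipschitzWith_restrict hr)
      (fun f => hA.measure_selfSimilar hX.measurable_restrict hfixA f)
      (fun f => hB.measure_selfSimilar hX.measurable_restrict hfixB f)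
      (fun f => by rw [hA.measure_univ, hB.measure_univ]) f

end IFS

end

/-! ### The dilation theorem -/

theorem mainTheorem7 {Y : Type*} [MetricSpace Y] [CompleteSpace Y]
    [TopologicalSpace.SeparableSpace Y] [MeasurableSpace Y] [BorelSpace Y]
    {N : ℕ} (hN : 2 ≤ N) (S : IFS Y N)
    (X : Set Y) (hX : S.IsAttractor X)
    (μ : Measure Y) (hμ : S.IsHutchinsonMeasure μ) :
    (∃! E : MSet (SeqSpace N) → Lp ℂ 2 (bernoulliMeasure N) →L[ℂ] Lp ℂ 2 (bernoulliMeasure N),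
      IsPVM E ∧ IsCuntzFixed E) ∧
    (∃! A : MSet X → Lp ℂ 2 (IFS.onSubtype μ X) →L[ℂ] Lp ℂ 2 (IFS.onSubtype μ X),
      IsPOVM A ∧ IFS.IsFixed hX hμ A) ∧
    ∃ V : Lp ℂ 2 (IFS.onSubtype μ X) →ₗᵢ[ℂ] Lp ℂ 2 (bernoulliMeasure N),
      (∀ f, V f =ᵐ[bernoulliMeasure N] f ∘ hX.coding) ∧
      ∀ (E : MSet (SeqSpace N) → Lp ℂ 2 (bernoulliMeasure N) →L[ℂ] Lp ℂ 2 (bernoulliMeasure N))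
        (A : MSet X → Lp ℂ 2 (IFS.onSubtype μ X) →L[ℂ] Lp ℂ 2 (IFS.onSubtype μ X)),
        IsPVM E → IsCuntzFixed E → IsPOVM A → IFS.IsFixed hX hμ A →
          IsPVM (fun Δ : MSet X => E (Δ.preimage hX.measurable_coding)) ∧
          ∀ Δ : MSet X,
            ContinuousLinearMap.adjoint V.toContinuousLinearMap ∘L
              E (Δ.preimage hX.measurable_coding) ∘L V.toContinuousLinearMap = A Δ := by
  have hE₀ := isPVM_indicatorL2 (bernoulliMeasure N)
  have hfix₀ := isCuntzFixed_indicatorL2 (N := N)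
  have hA₀ := IFS.isPOVM_compression hX hμ hE₀
  have hfixA₀ := IFS.isFixed_compression hX hμ hfix₀
  refine ⟨⟨_, ⟨hE₀, hfix₀⟩, fun E hE => hE.2.eq_of_isPVM hE.1 hfix₀ hE₀⟩,
    ⟨_, ⟨hA₀, hfixA₀⟩, fun A hA => hA.2.eq_of_isPOVM hA.1 hfixA₀ hA₀⟩,
    IFS.codingIsometry hX hμ, IFS.coeFn_codingIsometry hX hμ, ?_⟩
  intro E A hE hfixE hA hfixA
  have hEA := (IFS.isFixed_compression hX hμ hfixE).eq_of_isPOVM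
    (IFS.isPOVM_compression hX hμ hE) hfixA hA
  exact ⟨hE.map hX.measurable_coding, fun Δ => congrFun hEA Δ⟩
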